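/- Let $K\subset S^3$ be an oriented knot, given by a planar diagram, and choose a crossing of the diagram. Let $K^+$ and $K^-$ be the knots obtained by making this crossing positive, respectively negative, and leaving the rest of the diagram unchanged (so $K$ is one of the two). For a knot $L$ with Seifert matrix $V$ (the matrix of the form $(x,y)\mapsto \mathrm{lk}(x,y^+)$ on the first homology of a Seifert surface of $L$, where $y^+$ is the push-off of $y$ to the positive side) and $t\in S^1=\{t\in\mathbb{C} : |t|=1\}$, let $\sigma_t(L)$ be the signature (number of positive minus number of negative eigenvalues) of the Hermitian matrix $(1-t)V+(1-\bar t)V^T$, and let $\Delta(L)(t)=\det\left(t^{1/2}V-t^{-1/2}V^T\right)$ be the symmetrized Alexander polynomial; these do not depend on the choice of $V$ and of $t^{1/2}$. Let $\theta\in\mathbb{R}$ and $\rho=e^{i\theta}$, and suppose that $\Delta(K^+)(\rho)\,\Delta(K^-)(\rho)\neq 0$. Then the product $\Delta(K^+)(\rho)\,\Delta(K^-)(\rho)$ is real and $$ \sigma_\rho(K^-)-\sigma_\rho(K^+)=\begin{cases}2 & \text{if } \Delta(K^+)(\rho)\,\Delta(K^-)(\rho)<0,\\ 0 & \text{if } \Delta(K^+)(\rho)\,\Delta(K^-)(\rho)>0.\end{cases}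 $$ -/

import Mathlib

/-!
Oriented knots are given by oriented diagrams on the sphere, their Seifert matrices by the oriented
surface that Seifert's algorithm builds from a diagram, up to S-equivalence.
-/

/-- The shadow of an oriented knot diagram (a generic immersed oriented circle on the sphere) whose
set of double points is `X`.

At every double point `c` the two local branches are called `false` and `true`, in such a way that
(direction of branch `false`, direction of branch `true`) is a positively oriented frame: if branch
`false` runs from west to east, then branch `true` runs from south to north.
A pair `p = (c, i) : X × Bool` is the passage of the curve through `c` along branch `i`, and `next p`
is the passage that follows `p` along the oriented curve. Also, `p` labels the arc of the curve that
leaves `c` along branch `i`; this arc ends at the passage `next p`. -/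
structure Shadow (X : Type*) [Fintype X] where
  next : Equiv.Perm (X × Bool)
  /-- There is just one component: the passages form one cycle. -/
  connected : ∀ p q : X × Bool, next.SameCycle p q
  /-- The surface that carries the shadow is a sphere. Half-edges are pairs `(p, o)`, outgoing
  (`o = true`) or incoming (`o = false`) at the passage `p`. The map `turn` below rotates a half-edge
  counterclockwise to the neighbouring one at the same double point
  (east, north, west, south, that is, out `false`, out `true`, in `false`, in `true`), the map `flip`
  sends a half-edge to the other half of its arc, and the orbits of `turn ∘ flip` are the faces.
  By Euler's formula there are `#X + 2` of them, as there are `#X` vertices and `2 * #X` arcs. -/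
  planar :
    let turn : (X × Bool) × Bool → (X × Bool) × Bool :=
      fun h => ((h.1.1, !h.1.2), xor h.2 h.1.2)
    let flip : (X × Bool) × Bool → (X × Bool) × Bool :=
      fun h => if h.2 then (next h.1, false) else (next.symm h.1, true)
    Nat.card (Quot fun h h' => h' = turn (flip h)) = Fintype.card X + 2

namespace Shadow

variable {X : Type*} [Fintype X] (S : Shadow X)

/-- The orientation preserving smoothing of all double points. The curve that arrives at a double
point along one branch leaves along the other one. The cycles of this permutation of the arcs
`X × Bool` are the Seifert circles.

The arc `p = (c, i)` also labels the smoothed corner at `c` that precedes it. The double point `c`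
lies to the left of the corner `(c, false)` (which turns from south to east) and to the right of the
corner `(c, true)` (which turns from west to north). -/
def seifertPerm : Equiv.Perm (X × Bool) :=
  S.next.trans ((Equiv.refl X).prodCongr Equiv.boolNot)

/-- The set of Seifert circles. -/
abbrev SeifertCircle : Type _ :=
  Quotient (Equiv.Perm.SameCycle.setoid S.seifertPerm)

/-- The amount of a chain with weight `x c` on the band at `c` that enters a Seifert circle at a
corner: the band at `c` is oriented from the corner `(c, false)` to the corner `(c, true)`. -/
def inflow (x : X → ℤ) (p : X × Bool) : ℤ :=
  if p.2 then x p.1 else -x p.1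

/-- The first homology group of the Seifert surface `F` of the diagram. The surface consists of one
disc for every Seifert circle and of one band with a half twist at every double point `c`, which joins
the discs of the circles through the corners `(c, false)` and `(c, true)`.

A `1`-cycle of `F` is written as a pair `(x, u)`: it runs `x c` times along the band at `c`, and
`u p` times along the arc `p` of the boundary of a disc; the equation is Kirchhoff's law at the
corner `p`. The boundaries of the discs are the cycles with `x = 0`, `u` constant on every Seifert
circle. So every homology class has exactly one representative that is zero on a chosen arc
(`s.out`) of every Seifert circle `s`, and we work with these representatives. -/
def homology : Submodule ℤ ((X → ℤ) × (X × Bool → ℤ)) where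
  carrier := {z | (∀ p, z.2 p = z.2 (S.seifertPerm.symm p) + inflow z.1 p) ∧
    ∀ s : S.SeifertCircle, z.2 s.out = 0}
  zero_mem' := by simp [inflow]
  add_mem' := by
    rintro a b ⟨ha, ha'⟩ ⟨hb, hb'⟩
    refine ⟨fun p => ?_, fun s => by simp [ha', hb']⟩
    have h1 := ha p
    have h2 := hb p
    simp only [inflow, Prod.fst_add, Prod.snd_add, Pi.add_apply] at *
    split_ifs at * <;> linarith
  smul_mem' := by
    rintro k a ⟨ha, ha'⟩
    refine ⟨fun p => ?_, fun s => by simp [ha']⟩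
    have h1 := ha p
    simp only [inflow, Prod.smul_fst, Prod.smul_snd, Pi.smul_apply, smul_eq_mul] at *
    rw [h1]
    split_ifs <;> ring

end Shadow

/-- An oriented knot diagram: a shadow with the sign (`1` or `-1`) of every crossing. The sign is that
of the frame (direction of the over-strand, direction of the under-strand), so that branch `false` is
the over-strand at a positive crossing and branch `true` is the over-strand at a negative one. -/
structure KnotDiagram (X : Type*) [Fintype X] extends Shadow X where
  sign : X → ℤˣ

namespace KnotDiagram

variable {X : Type*} [Fintype X] (K : KnotDiagram X)

/-- The diagram in which the crossing `c` is made positive (`e = 1`) or negative (`e = -1`), and which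
is unchanged elsewhere. -/
def withSign [DecidableEq X] (c : X) (e : ℤˣ) : KnotDiagram X :=
  { K with sign := Function.update K.sign c e }

/-- The Seifert form `(z, w) ↦ lk(z, w⁺)`, where `w⁺` is `w` pushed off the surface to its positive
side (the surface is oriented such that its oriented boundary is the knot).

The linking number is the number of crossings at which `z` runs over `w⁺`, counted with signs. To see
them, let every disc start with a vertical collar above its Seifert circle and close up to a dome above
it (the domes are nested as the circles are), let the bands be attached to the lower rims of the collars,
and let `w` run along the collars higher than `z`. The positive normal of a collar points to the right
of its Seifert circle, so it points upwards in a band that is attached from the right, and downwards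
in a band that is attached from the left. Hence `z` runs over `w⁺` only at the corners `(c, false)`,
where `w⁺` enters the band to the left below the collar. This crossing has sign `+1`, and it is
located just behind the band end if the half twist is that of a positive crossing, and just before
it if the half twist is that of a negative crossing; no further crossing is then needed in
the band to lead `w⁺` from below `z` to above `z`. -/
def seifertForm (z w : K.homology) : ℤ :=
  ∑ c : X, w.1.1 c *
    (if K.sign c = 1 then z.1.2 (c, false) else z.1.2 (K.seifertPerm.symm (c, false)))

end KnotDiagram

namespace Matrix

/-- The elementary enlargement of a square matrix `V` by a column vector `ξ`:
`V` becomes `[V, ξ, 0; 0, 0, 1; 0, 0, 0]`. -/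
def enlargeCol {n : ℕ} (V : Matrix (Fin n) (Fin n) ℤ) (ξ : Fin n → ℤ) :
    Matrix (Fin (n + 2)) (Fin (n + 2)) ℤ :=
  Matrix.reindex finSumFinEquiv finSumFinEquiv
    (Matrix.fromBlocks V (Matrix.of fun i => ![ξ i, 0]) 0 !![0, 1; 0, 0])

/-- The elementary enlargement of a square matrix `V` by a row vector `ξ`:
`V` becomes `[V, 0, 0; ξ, 0, 0; 0, 1, 0]`. -/
def enlargeRow {n : ℕ} (V : Matrix (Fin n) (Fin n) ℤ) (ξ : Fin n → ℤ) :
    Matrix (Fin (n + 2)) (Fin (n + 2)) ℤ :=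
  Matrix.reindex finSumFinEquiv finSumFinEquiv
    (Matrix.fromBlocks V 0 (Matrix.of ![ξ, 0]) !![0, 0; 1, 0])

/-- S-equivalence of integral square matrices: the equivalence relation that is generated by unimodular
congruence and elementary enlargement. -/
inductive SEquiv : ∀ {m n : ℕ}, Matrix (Fin m) (Fin m) ℤ → Matrix (Fin n) (Fin n) ℤ → Prop
  | refl {n : ℕ} (V : Matrix (Fin n) (Fin n) ℤ) : SEquiv V V
  | symm {m n : ℕ} {V : Matrix (Fin m) (Fin m) ℤ} {W : Matrix (Fin n) (Fin n) ℤ} :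
      SEquiv V W → SEquiv W V
  | trans {l m n : ℕ} {U : Matrix (Fin l) (Fin l) ℤ} {V : Matrix (Fin m) (Fin m) ℤ}
      {W : Matrix (Fin n) (Fin n) ℤ} : SEquiv U V → SEquiv V W → SEquiv U W
  | congr {n : ℕ} (V P : Matrix (Fin n) (Fin n) ℤ) : IsUnit P.det → SEquiv V (P * V * Pᵀ)
  | enlargeCol {n : ℕ} (V : Matrix (Fin n) (Fin n) ℤ) (ξ : Fin n → ℤ) : SEquiv V (V.enlargeCol ξ)
  | enlargeRow {n : ℕ} (V : Matrix (Fin n) (Fin n) ℤ) (ξ : Fin n → ℤ) : SEquiv V (V.enlargeRow ξ)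

end Matrix

/-- `V` is a Seifert matrix of the knot with diagram `K`: it is S-equivalent to the matrix of the Seifert
form of the surface that Seifert's algorithm builds from `K`, in some basis of its first homology.
(All Seifert surfaces of a knot have S-equivalent matrices, so all of these matrices are included,
whichever surface, basis and diagram of the knot is used.) -/
def KnotDiagram.IsSeifertMatrix {X : Type*} [Fintype X] (K : KnotDiagram X) {n : ℕ}
    (V : Matrix (Fin n) (Fin n) ℤ) : Prop :=
  ∃ (m : ℕ) (b : Module.Basis (Fin m) ℤ K.homology),
    Matrix.SEquiv (Matrix.of fun i j => K.seifertForm (b i) (b j)) V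

namespace Matrix

/-- The signature of a Hermitian matrix: the number of its positive eigenvalues minus the number of its
negative eigenvalues. -/
noncomputable def IsHermitian.signature {n : ℕ} {M : Matrix (Fin n) (Fin n) ℂ}
    (hM : M.IsHermitian) : ℤ :=
  (Nat.card {i // 0 < hM.eigenvalues i} : ℤ) - (Nat.card {i // hM.eigenvalues i < 0} : ℤ)

/-- The matrix `B(t) = (1 - t) V + (1 - t̄) Vᵀ`. -/
noncomputable def seifertHermitian {n : ℕ} (V : Matrix (Fin n) (Fin n) ℤ) (t : ℂ) :
    Matrix (Fin n) (Fin n) ℂ :=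
  (1 - t) • V.map (Int.cast : ℤ → ℂ) + (1 - star t) • (V.map (Int.cast : ℤ → ℂ))ᵀ

theorem seifertHermitian_isHermitian {n : ℕ} (V : Matrix (Fin n) (Fin n) ℤ) (t : ℂ) :
    (V.seifertHermitian t).IsHermitian := by
  ext i j
  simp [seifertHermitian, add_comm]

/-- The value at `t` of the signature function of a knot with Seifert matrix `V`. -/
noncomputable def signatureAt {n : ℕ} (V : Matrix (Fin n) (Fin n) ℤ) (t : ℂ) : ℤ :=
  (V.seifertHermitian_isHermitian t).signature

/-- The value at `t = s ^ 2` of the symmetrized Alexander polynomial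
`det (t ^ (1/2) V - t ^ (-1/2) Vᵀ)` of a knot with Seifert matrix `V`, where `s = t ^ (1/2)`.
(A Seifert matrix of a knot has even size, so the choice of the square root does not matter.) -/
noncomputable def alexanderAt {n : ℕ} (V : Matrix (Fin n) (Fin n) ℤ) (s : ℂ) : ℂ :=
  (s • V.map (Int.cast : ℤ → ℂ) - s⁻¹ • (V.map (Int.cast : ℤ → ℂ))ᵀ).det

end Matrix

/-! Changing a crossing keeps the shadow, so both Seifert forms live on the same homology group. By
Kirchhoff's law at that crossing they differ by the square of the linear form `z ↦ z.1.1 c`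
(`seifertForm_withSign`), so in one basis `V₊ = V₋ - a aᵀ`. For `|t| = 1` the Hermitian forms then
differ by `|1 - t|²` times the square of the modulus of a linear form. Subtracting such a form
lowers the number of positive eigenvalues by at most one (`index_sub_rank_one`). If both forms are
nondegenerate, the signature therefore drops by 0 or 2.

The parity of the number of negative eigenvalues decides which, and this is the sign of the
determinant. Since `det B(s²) = (s⁻¹ - s)ⁿ Δ(s)`, where the first factor is real for even `n`, the
product of the two Alexander values carries the needed sign. The size is even because the surface of
a knot diagram has even first Betti number (`even_finrank_homology`).

Passing to arbitrary Seifert matrices takes invariance under S-equivalence: `SEquiv.alexanderAt_eq`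
for `s ≠ 0`, and `SEquiv.signatureAt_eq` where the form is nondegenerate. At `t = 1` the form
vanishes, and that case is treated apart. -/

/-! ### Signs of permutations and numbers of cycles -/

namespace Equiv.Perm

/-- The sign of a permutation in terms of its number of cycles, fixed points included. -/
theorem sign_eq_neg_one_pow_card_add_card_quotient {α : Type*} [Fintype α] [DecidableEq α]
    (f : Perm α) :
    sign f = (-1) ^ (Fintype.card α + Nat.card (Quotient (SameCycle.setoid f))) := by
  have hne : ∀ c : f.cycleFactorsFinset, ∃ x, f.cycleOf x = c ∧ f x ≠ x := by
    rintro ⟨c, hc⟩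
    obtain ⟨x, hx⟩ := (mem_cycleFactorsFinset_iff.1 hc).1.nonempty_support
    have hx' := cycle_is_cycleOf hx hc
    refine ⟨x, hx'.symm, ?_⟩
    rw [← mem_support, ← cycleOf_mem_cycleFactorsFinset_iff, ← hx']
    exact hc
  choose a ha ha' using hne
  let g : f.cycleFactorsFinset ⊕ Function.fixedPoints f → Quotient (SameCycle.setoid f) :=
    Sum.elim (fun c => Quotient.mk _ (a c)) (fun x => Quotient.mk _ x.1)
  have hg : Function.Bijective g := by
    constructor
    · rintro (c | x) (d | y) h
      · have h' : SameCycle f (a c) (a d) := Quotient.exact h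
        have := h'.cycleOf_eq
        rw [ha, ha] at this
        rw [Subtype.ext this]
      · have h' : SameCycle f (a c) y := Quotient.exact h
        exact absurd (h'.apply_eq_self_iff.2 y.2) (ha' c)
      · have h' : SameCycle f x (a d) := Quotient.exact h
        exact absurd (h'.apply_eq_self_iff.1 x.2) (ha' d)
      · have h' : SameCycle f x y := Quotient.exact h
        have : x.1 = y.1 := h'.eq_of_left x.2
        rw [Subtype.ext this]
    · intro q
      induction q using Quotient.inductionOn with | h x => ?_
      by_cases hx : f x = x
      · exact ⟨Sum.inr ⟨x, hx⟩, rfl⟩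
      · have hc : f.cycleOf x ∈ f.cycleFactorsFinset :=
          cycleOf_mem_cycleFactorsFinset_iff.2 (mem_support.2 hx)
        refine ⟨Sum.inl ⟨_, hc⟩, Quotient.sound ?_⟩
        have h1 := ha ⟨_, hc⟩
        exact ((sameCycle_iff_cycleOf_eq_of_mem_support (mem_support.2 (ha' ⟨_, hc⟩))
          (mem_support.2 hx)).2 h1)
  have hcard := Nat.card_congr (Equiv.ofBijective g hg)
  have h1 := card_fixedPoints f
  have h2 : Multiset.card f.cycleType = f.cycleFactorsFinset.card := by
    simp [cycleType_def]
  have h3 : f.support.card ≤ Fintype.card α := Finset.card_le_univ _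
  rw [Nat.card_sum, Nat.card_eq_fintype_card, Nat.card_eq_fintype_card, Fintype.card_coe, ← h2,
    h1] at hcard
  rw [sum_cycleType] at hcard
  rw [sign_of_cycleType, sum_cycleType, ← hcard]
  -- Every fixed point is counted twice, as an element and as a cycle, which does not affect the
  -- sign.
  have h4 : Fintype.card α + (Multiset.card f.cycleType + (Fintype.card α - f.support.card)) =
    f.support.card + Multiset.card f.cycleType + 2 * (Fintype.card α - f.support.card) := by
    omega
  rw [h4, pow_add _ _ (2 * _), pow_mul]
  simp

end Equiv.Perm

/-! ### Parity of the first Betti number of the Seifert surface -/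

theorem LinearMap.finrank_range_add_finrank_ker_int {M N : Type*} [AddCommGroup M] [AddCommGroup N]
    [Module.Finite ℤ M] (f : M →ₗ[ℤ] N) :
    Module.finrank ℤ (LinearMap.range f) + Module.finrank ℤ (LinearMap.ker f) =
      Module.finrank ℤ M := by
  rw [← f.quotKerEquivRange.finrank_eq]
  exact Submodule.finrank_quotient_add_finrank _

namespace Shadow

variable {X : Type*} [Fintype X] (S : Shadow X)

theorem seifertPerm_apply (p : X × Bool) :
    S.seifertPerm p = ((S.next p).1, !(S.next p).2) := rfl

/-- A knot has one component, so `next` is a single cycle of even length `2 * #X`, hence odd. The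
exchange of branches is a product of `#X` transpositions. -/
theorem sign_seifertPerm [DecidableEq X] [Nonempty X] :
    Equiv.Perm.sign S.seifertPerm = (-1) ^ (Fintype.card X + 1) := by
  have h1 : Equiv.Perm.sign S.next = -1 := by
    have : Nat.card (Quotient (Equiv.Perm.SameCycle.setoid S.next)) = 1 := by
      rw [Nat.card_eq_one_iff_unique]
      refine ⟨⟨fun a b => ?_⟩, ⟨Quotient.mk _ (Classical.arbitrary (X × Bool))⟩⟩
      induction a, b using Quotient.inductionOn₂ with | h p q => ?_
      exact Quotient.sound (S.connected p q)
    rw [Equiv.Perm.sign_eq_neg_one_pow_card_add_card_quotient, this, Fintype.card_prod,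
      Fintype.card_bool, mul_comm, pow_add, pow_mul]
    simp
  have h2 : Equiv.Perm.sign ((Equiv.refl X).prodCongr Equiv.boolNot) = (-1) ^ Fintype.card X := by
    have h3 : (Equiv.refl X).prodCongr Equiv.boolNot =
        Equiv.prodCongrRight fun _ : X => Equiv.boolNot := by
      ext <;> rfl
    have h4 : Equiv.Perm.sign Equiv.boolNot = -1 := by decide
    rw [h3, Equiv.Perm.sign_prodCongrRight, Finset.prod_congr rfl fun _ _ => h4]
    simp
  rw [seifertPerm, Equiv.Perm.sign_trans, h1, h2, pow_succ]

/-- The number of Seifert circles of a knot diagram has the parity of the number of crossings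
plus one. -/
theorem even_card_add_card_seifertCircle [Nonempty X] :
    Even (Fintype.card X + 1 + Nat.card S.SeifertCircle) := by
  classical
  have h := S.sign_seifertPerm
  rw [Equiv.Perm.sign_eq_neg_one_pow_card_add_card_quotient, Fintype.card_prod, Fintype.card_bool,
    mul_comm, pow_add, pow_mul] at h
  simp only [even_two, Even.neg_pow, one_pow, one_mul] at h
  have h' : (-1 : ℤˣ) ^ (Fintype.card X + 1 + Nat.card S.SeifertCircle) = 1 := by
    rw [pow_add, ← h, ← pow_add, ← two_mul, pow_mul]
    simp
  exact (neg_one_pow_eq_one_iff_even (by decide)).1 h'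

/-- The defect of a chain in Kirchhoff's law, and its values on the chosen arcs. -/
noncomputable def kirchhoff : ((X → ℤ) × (X × Bool → ℤ)) →ₗ[ℤ] (X × Bool → ℤ) × (S.SeifertCircle → ℤ) where
  toFun z := (fun p => z.2 p - z.2 (S.seifertPerm.symm p) - inflow z.1 p, fun s => z.2 s.out)
  map_add' z w := by
    refine Prod.ext (funext fun p => ?_) rfl
    simp only [inflow, Prod.fst_add, Prod.snd_add, Pi.add_apply]
    split_ifs <;> ring
  map_smul' k z := by
    refine Prod.ext (funext fun p => ?_) rfl
    simp only [inflow, Prod.smul_fst, Prod.smul_snd, Pi.smul_apply, smul_eq_mul,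
      RingHom.id_apply]
    split_ifs <;> ring

theorem ker_kirchhoff : LinearMap.ker S.kirchhoff = S.homology := by
  ext z
  simp only [LinearMap.mem_ker, kirchhoff, LinearMap.coe_mk, AddHom.coe_mk, Prod.ext_iff,
    funext_iff]
  refine and_congr (forall_congr' fun p => ?_) Iff.rfl
  simp only [Prod.fst_zero, Pi.zero_apply]
  constructor <;> intro h <;> linarith

/-- The sum of the defects of a chain in Kirchhoff's law at all corners. -/
noncomputable def totalDefect : (X × Bool → ℤ) × (S.SeifertCircle → ℤ) →ₗ[ℤ] ℤ :=
  (∑ p, LinearMap.proj p) ∘ₗ LinearMap.fst ℤ _ _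

theorem totalDefect_apply (y : (X × Bool → ℤ) × (S.SeifertCircle → ℤ)) :
    S.totalDefect y = ∑ p, y.1 p := by
  simp [totalDefect]

theorem sum_inflow (x : X → ℤ) : ∑ p, inflow x p = 0 := by
  simp [Fintype.sum_prod_type, inflow]

/-- A unit of defect can be moved along an arc of a disc, from `p` to `seifertPerm p`, and across a
band, between the two corners at a double point. Together these moves follow `next`, which is
transitive. -/
theorem single_sub_single_mem [DecidableEq X] (p q : X × Bool) :
    ∃ z, (S.kirchhoff z).1 = Pi.single p 1 - Pi.single q 1 := by
  let M : Submodule ℤ (X × Bool → ℤ) := LinearMap.range (LinearMap.fst ℤ _ _ ∘ₗ S.kirchhoff)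
  have h1 : ∀ p, Pi.single (S.seifertPerm p) 1 - Pi.single p 1 ∈ M := by
    intro p
    refine ⟨(0, -Pi.single p 1), funext fun q => ?_⟩
    simp only [kirchhoff, LinearMap.comp_apply, LinearMap.coe_mk, AddHom.coe_mk,
      LinearMap.fst_apply, inflow, Pi.neg_apply, Pi.sub_apply, Pi.zero_apply, Pi.single_apply,
      Equiv.symm_apply_eq]
    split_ifs <;> simp
  have h2 : ∀ c, Pi.single (c, false) 1 - Pi.single (c, true) 1 ∈ M := by
    intro c
    refine ⟨(Pi.single c 1, 0), funext fun q => ?_⟩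
    obtain ⟨d, i⟩ := q
    simp only [kirchhoff, LinearMap.comp_apply, LinearMap.coe_mk, AddHom.coe_mk,
      LinearMap.fst_apply, inflow, Pi.sub_apply, Pi.zero_apply, Pi.single_apply]
    cases i <;> by_cases hd : d = c <;> simp [hd]
  have h3 : ∀ p, Pi.single (S.next p) 1 - Pi.single p 1 ∈ M := by
    intro p
    have h := h1 p
    rw [seifertPerm_apply] at h
    have h' := h2 (S.next p).1
    rcases hp : S.next p with ⟨d, i⟩
    rw [hp] at h h'
    cases i
    · simpa using M.add_mem h h'
    · simpa using M.sub_mem h h'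
  have h4 : ∀ (k : ℕ) (p), Pi.single ((S.next ^ k) p) 1 - Pi.single p 1 ∈ M := by
    intro k p
    induction k with
    | zero => simp
    | succ k ih =>
      rw [pow_succ', Equiv.Perm.mul_apply]
      simpa using M.add_mem (h3 ((S.next ^ k) p)) ih
  obtain ⟨k, -, hk⟩ := (S.connected q p).exists_pow_eq'
  have := h4 k q
  rw [hk] at this
  exact this

/-- Boundaries of discs have no defect, so they adjust the values on the chosen arcs freely. -/
theorem kirchhoff_comp_mk_fst (v : S.SeifertCircle → ℤ) :
    S.kirchhoff (0, fun p => v (Quotient.mk _ p)) = (0, v) := by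
  refine Prod.ext (funext fun p => ?_) (funext fun s => ?_)
  · have : (Quotient.mk _ p : S.SeifertCircle) = Quotient.mk _ (S.seifertPerm.symm p) := by
      refine Quotient.sound ?_
      exact ⟨-1, by simp⟩
    simp [kirchhoff, inflow, this]
  · simp [kirchhoff]

/-- Arcs and bands contribute to the defect at their two ends with opposite signs. Conversely, all
defects can be moved to one corner `q`, where they cancel if their sum is zero. -/
theorem range_kirchhoff [Nonempty X] :
    LinearMap.range S.kirchhoff = LinearMap.ker S.totalDefect := by
  classical
  apply le_antisymm
  · rintro _ ⟨z, rfl⟩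
    rw [LinearMap.mem_ker, totalDefect_apply]
    simp only [kirchhoff, LinearMap.coe_mk, AddHom.coe_mk, Finset.sum_sub_distrib, sum_inflow,
      sub_zero]
    rw [Equiv.sum_comp S.seifertPerm.symm z.2, sub_self]
  · intro y hy
    rw [LinearMap.mem_ker, totalDefect_apply] at hy
    let q : X × Bool := Classical.arbitrary _
    choose z hz using fun p => S.single_sub_single_mem p q
    have h1 : (S.kirchhoff (∑ p, y.1 p • z p)).1 = y.1 := by
      rw [map_sum, Prod.fst_sum]
      simp only [map_smul, Prod.smul_fst, hz, smul_sub, Finset.sum_sub_distrib]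
      rw [← Finset.sum_smul, hy, zero_smul, sub_zero]
      ext p
      simp [Finset.sum_apply, Pi.single_apply]
    let v := y.2 - (S.kirchhoff (∑ p, y.1 p • z p)).2
    refine ⟨(∑ p, y.1 p • z p) + (0, fun p => v (Quotient.mk _ p)), ?_⟩
    rw [map_add, kirchhoff_comp_mk_fst]
    refine Prod.ext ?_ ?_
    · rw [Prod.fst_add, h1, add_zero]
    · simp [v]

/-- The first Betti number of the Seifert surface. -/
theorem finrank_homology [Nonempty X] :
    Module.finrank ℤ S.homology + Nat.card S.SeifertCircle = Fintype.card X + 1 := by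
  classical
  -- There are `3 * #X` coefficients, and `2 * #X` conditions at corners plus one per circle; the
  -- image has corank one, by the total defect.
  have h1 := S.kirchhoff.finrank_range_add_finrank_ker_int
  have h2 := S.totalDefect.finrank_range_add_finrank_ker_int
  have h3 : LinearMap.range S.totalDefect = ⊤ := by
    rw [LinearMap.range_eq_top]
    intro k
    refine ⟨(Pi.single (Classical.arbitrary _) k, 0), ?_⟩
    simp [totalDefect_apply]
  rw [S.range_kirchhoff, S.ker_kirchhoff] at h1
  rw [h3, finrank_top] at h2
  simp only [Module.finrank_prod, Module.finrank_fintype_fun_eq_card, Fintype.card_prod,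
    Fintype.card_bool, Module.finrank_self] at h1 h2
  rw [Nat.card_eq_fintype_card]
  omega

theorem even_finrank_homology [Nonempty X] : Even (Module.finrank ℤ S.homology) := by
  have h1 := S.finrank_homology
  have h2 := S.even_card_add_card_seifertCircle
  rw [Nat.even_iff] at *
  omega

end Shadow

/-! ### Inertia of Hermitian forms -/

namespace Matrix

section Inertia

variable {n : Type*} [Fintype n]

/-- The real value of a Hermitian form at a vector. -/
noncomputable def hermitianValue (M : Matrix n n ℂ) (x : n → ℂ) : ℝ :=
  (star x ⬝ᵥ M *ᵥ x).re

theorem hermitianValue_conj {m : Type*} [Fintype m] (M : Matrix n n ℂ) (P : Matrix m n ℂ)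
    (x : m → ℂ) : (P * M * Pᴴ).hermitianValue x = M.hermitianValue (Pᴴ *ᵥ x) := by
  rw [hermitianValue, hermitianValue, star_mulVec, conjTranspose_conjTranspose, ← mulVec_mulVec,
    ← mulVec_mulVec, dotProduct_mulVec]

theorem hermitianValue_submatrix {m : Type*} [Fintype m] (M : Matrix n n ℂ) (e : m ≃ n)
    (x : n → ℂ) : (M.submatrix e e).hermitianValue (x ∘ e) = M.hermitianValue x := by
  have h1 : M.submatrix e e *ᵥ (x ∘ e) = (M *ᵥ x) ∘ e := by
    rw [submatrix_mulVec_equiv]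
    simp [Function.comp_assoc]
  rw [hermitianValue, hermitianValue, h1]
  congr 1
  exact Equiv.sum_comp e fun i => star x i * (M *ᵥ x) i

theorem hermitianValue_diagonal [DecidableEq n] (d : n → ℝ) (x : n → ℂ) :
    (diagonal fun i => (d i : ℂ)).hermitianValue x = ∑ i, d i * Complex.normSq (x i) := by
  simp only [hermitianValue, dotProduct, mulVec_diagonal, Complex.re_sum]
  refine Finset.sum_congr rfl fun i _ => ?_
  simp [Complex.normSq_apply]
  ring

variable [DecidableEq n] {M : Matrix n n ℂ} (hM : M.IsHermitian)

namespace IsHermitian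

/-- The number of positive (`ε = 1`) or negative (`ε = -1`) eigenvalues of a Hermitian matrix. -/
noncomputable def index (ε : ℝ) : ℕ :=
  Nat.card {i // 0 < ε * hM.eigenvalues i}

theorem hermitianValue_eq_sum (x : n → ℂ) :
    M.hermitianValue x =
      ∑ i, hM.eigenvalues i *
        Complex.normSq (((hM.eigenvectorUnitary : Matrix n n ℂ)ᴴ *ᵥ x) i) := by
  have h := hM.spectral_theorem
  rw [Unitary.conjStarAlgAut_apply] at h
  conv_lhs => rw [h]
  rw [star_eq_conjTranspose, hermitianValue_conj]
  exact hermitianValue_diagonal _ _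

/-- A space on which a Hermitian form is definite has at most the dimension of the index. -/
theorem finrank_le_index {V : Type*} [AddCommGroup V] [Module ℂ V] [FiniteDimensional ℂ V] (ε : ℝ)
    (f : V →ₗ[ℂ] n → ℂ) (hf : ∀ v, v ≠ 0 → 0 < ε * M.hermitianValue (f v)) :
    Module.finrank ℂ V ≤ hM.index ε := by
  by_contra! hlt
  -- The components along the eigenvectors of sign `ε`. A nonzero vector in the kernel of `g`
  -- involves only the other eigenvectors, which contradicts definiteness.
  let g : V →ₗ[ℂ] ({i // 0 < ε * hM.eigenvalues i} → ℂ) :=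
    LinearMap.funLeft ℂ ℂ Subtype.val ∘ₗ
      (hM.eigenvectorUnitary : Matrix n n ℂ)ᴴ.mulVecLin ∘ₗ f
  have hg : LinearMap.ker g ≠ ⊥ := by
    refine LinearMap.ker_ne_bot_of_finrank_lt ?_
    rwa [Module.finrank_fintype_fun_eq_card, ← Nat.card_eq_fintype_card]
  obtain ⟨v, hv, hv0⟩ := Submodule.exists_mem_ne_zero_of_ne_bot hg
  refine (hf v hv0).not_ge ?_
  rw [hM.hermitianValue_eq_sum, Finset.mul_sum]
  refine Finset.sum_nonpos fun i _ => ?_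
  by_cases hi : 0 < ε * hM.eigenvalues i
  · have : ((hM.eigenvectorUnitary : Matrix n n ℂ)ᴴ *ᵥ f v) i = 0 := congrFun hv ⟨i, hi⟩
    rw [this]
    simp
  · rw [← mul_assoc]
    exact mul_nonpos_of_nonpos_of_nonneg (not_lt.1 hi) (Complex.normSq_nonneg _)

/-- A Hermitian form is definite on a space whose dimension is the index. -/
theorem exists_definite (ε : ℝ) :
    ∃ f : ({i // 0 < ε * hM.eigenvalues i} → ℂ) →ₗ[ℂ] n → ℂ,
      ∀ v, v ≠ 0 → 0 < ε * M.hermitianValue (f v) := by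
  classical
  let U : Matrix n n ℂ := hM.eigenvectorUnitary
  have hU : Uᴴ * U = 1 := Unitary.coe_star_mul_self hM.eigenvectorUnitary
  let g : ({i // 0 < ε * hM.eigenvalues i} → ℂ) →ₗ[ℂ] n → ℂ :=
    LinearMap.pi fun i => if h : 0 < ε * hM.eigenvalues i then LinearMap.proj ⟨i, h⟩ else 0
  refine ⟨U.mulVecLin ∘ₗ g, fun v hv => ?_⟩
  rw [hM.hermitianValue_eq_sum, Finset.mul_sum]
  have h1 : Uᴴ *ᵥ (U.mulVecLin ∘ₗ g) v = g v := by
    simp [mulVec_mulVec, hU]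
  change 0 < ∑ i, ε * (_ * Complex.normSq ((Uᴴ *ᵥ (U.mulVecLin ∘ₗ g) v) i))
  rw [h1]
  obtain ⟨⟨i, hi⟩, hvi⟩ := Function.ne_iff.1 hv
  refine Finset.sum_pos' (fun j _ => ?_) ⟨i, Finset.mem_univ _, ?_⟩
  · rw [← mul_assoc]
    by_cases hj : 0 < ε * hM.eigenvalues j
    · exact mul_nonneg hj.le (Complex.normSq_nonneg _)
    · simp [g, hj]
  · rw [← mul_assoc]
    refine mul_pos hi (Complex.normSq_pos.2 ?_)
    simpa [g, hi] using hvi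

theorem index_add_index (hdet : M.det ≠ 0) :
    hM.index 1 + hM.index (-1) = Fintype.card n := by
  classical
  have h0 : ∀ i, hM.eigenvalues i ≠ 0 := by
    intro i hi
    apply hdet
    rw [hM.det_eq_prod_eigenvalues]
    exact Finset.prod_eq_zero (Finset.mem_univ i) (by simp [hi])
  have h1 : hM.index (-1) = Fintype.card {i // ¬ 0 < 1 * hM.eigenvalues i} := by
    rw [index, Nat.card_eq_fintype_card]
    refine Fintype.card_congr (Equiv.subtypeEquivRight fun i => ?_)
    rw [one_mul, neg_one_mul, neg_pos, not_lt, le_iff_lt_or_eq, or_iff_left (h0 i)]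
  rw [h1, index, Nat.card_eq_fintype_card]
  rw [Fintype.card_subtype_compl]
  exact Nat.add_sub_of_le (Fintype.card_subtype_le _)

/-- This recovers the parity of the number of negative eigenvalues from the determinant. -/
theorem det_pos_of_index (hdet : M.det ≠ 0) : 0 < (-1) ^ hM.index (-1) * M.det.re := by
  classical
  have h1 : M.det.re = ∏ i, hM.eigenvalues i := by
    rw [hM.det_eq_prod_eigenvalues]
    norm_cast
  have h2 : (-1 : ℝ) ^ hM.index (-1) =
      ∏ i, if 0 < -1 * hM.eigenvalues i then (-1 : ℝ) else 1 := by
    rw [Finset.prod_ite, Finset.prod_const, Finset.prod_const_one, mul_one, index,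
      Nat.card_eq_fintype_card, Fintype.card_subtype]
  rw [h1, h2, ← Finset.prod_mul_distrib]
  refine Finset.prod_pos fun i _ => ?_
  have h0 : hM.eigenvalues i ≠ 0 := by
    intro hi
    apply hdet
    rw [hM.det_eq_prod_eigenvalues]
    exact Finset.prod_eq_zero (Finset.mem_univ i) (by simp [hi])
  split_ifs with hi
  · exact hi
  · rw [one_mul]
    exact lt_of_le_of_ne (by linarith) h0.symm

/-- Subtracting a positive semidefinite form of rank at most one does not increase the number of
positive eigenvalues, and decreases it by at most one. -/
theorem index_sub_rank_one {N : Matrix n n ℂ} (hN : N.IsHermitian) {k : ℝ} (hk : 0 ≤ k)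
    (l : (n → ℂ) →ₗ[ℂ] ℂ)
    (h : ∀ x, N.hermitianValue x = M.hermitianValue x - k * Complex.normSq (l x)) :
    hN.index 1 ≤ hM.index 1 ∧ hM.index 1 ≤ hN.index 1 + 1 := by
  constructor
  · obtain ⟨f, hf⟩ := hN.exists_definite 1
    have := hM.finrank_le_index 1 f fun v hv => by
      have h1 := hf v hv
      have h2 := mul_nonneg hk (Complex.normSq_nonneg (l (f v)))
      rw [h] at h1
      linarith
    rwa [Module.finrank_fintype_fun_eq_card, ← Nat.card_eq_fintype_card] at this
  · obtain ⟨f, hf⟩ := hM.exists_definite 1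
    -- On the kernel of `l` the two forms agree, and this kernel has codimension at most one in the
    -- positive definite space.
    have h1 := hN.finrank_le_index 1 (f ∘ₗ (LinearMap.ker (l ∘ₗ f)).subtype) fun v hv => by
      have h2 : l (f v) = 0 := v.2
      rw [h]
      simpa [h2] using hf v (by simpa using hv)
    have h3 := (l ∘ₗ f).finrank_range_add_finrank_ker
    have h4 : Module.finrank ℂ (LinearMap.range (l ∘ₗ f)) ≤ 1 := by
      simpa using (LinearMap.range (l ∘ₗ f)).finrank_le
    rw [Module.finrank_fintype_fun_eq_card, ← Nat.card_eq_fintype_card] at h3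
    rw [index]
    omega

end IsHermitian

end Inertia

namespace IsHermitian

theorem signature_eq {n : ℕ} {M : Matrix (Fin n) (Fin n) ℂ} (hM : M.IsHermitian) :
    hM.signature = hM.index 1 - hM.index (-1) := by
  simp [signature, index]

/-- For nondegenerate forms the two indices add up to the size. Hence the lower bounds for both
signs already exhaust `m + 2 * k` and are equalities. -/
theorem signature_eq_of_index_le {m n k : ℕ} {M : Matrix (Fin m) (Fin m) ℂ}
    {N : Matrix (Fin n) (Fin n) ℂ} (hM : M.IsHermitian) (hN : N.IsHermitian) (hM0 : M.det ≠ 0)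
    (hN0 : N.det ≠ 0) (hmn : n = m + 2 * k)
    (h : ∀ ε : ℝ, ε * ε = 1 → hM.index ε + k ≤ hN.index ε) : hM.signature = hN.signature := by
  have h1 := hM.index_add_index hM0
  have h2 := hN.index_add_index hN0
  have h3 := h 1 (by norm_num)
  have h4 := h (-1) (by norm_num)
  rw [Fintype.card_fin] at h1 h2
  rw [signature_eq, signature_eq]
  omega

end IsHermitian

end Matrix

/-! ### Invariance under S-equivalence -/

namespace Matrix

section SEquivalence

variable {n : ℕ} (V : Matrix (Fin n) (Fin n) ℤ)

theorem seifertHermitian_transpose (t : ℂ) :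
    Vᵀ.seifertHermitian t = V.seifertHermitian (star t) := by
  ext i j
  simp [seifertHermitian, add_comm]

theorem signatureAt_transpose (t : ℂ) : Vᵀ.signatureAt t = V.signatureAt (star t) := by
  unfold signatureAt
  congr 1
  exact V.seifertHermitian_transpose t

theorem alexanderAt_transpose (s : ℂ) : Vᵀ.alexanderAt s = V.alexanderAt s := by
  rw [alexanderAt, alexanderAt, ← det_transpose]
  congr 1

theorem alexanderAt_inv (s : ℂ) : V.alexanderAt s⁻¹ = (-1) ^ n * V.alexanderAt s := by
  have h : s⁻¹ • V.map (Int.cast : ℤ → ℂ) - s⁻¹⁻¹ • (V.map Int.cast)ᵀ =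
      -(s • V.map (Int.cast : ℤ → ℂ) - s⁻¹ • (V.map Int.cast)ᵀ)ᵀ := by
    rw [transpose_sub, transpose_smul, transpose_smul, transpose_transpose, neg_sub, inv_inv]
  rw [alexanderAt, h, det_neg, det_transpose, Fintype.card_fin, alexanderAt]

/-- This reduces row enlargements to column enlargements, as transposition keeps the Alexander value
and conjugates the argument of the signature. -/
theorem enlargeRow_eq_transpose (ξ : Fin n → ℤ) : V.enlargeRow ξ = (Vᵀ.enlargeCol ξ)ᵀ := by
  ext i j
  obtain ⟨i, rfl⟩ := finSumFinEquiv.surjective i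
  obtain ⟨j, rfl⟩ := finSumFinEquiv.surjective j
  simp only [enlargeRow, enlargeCol, transpose_apply, reindex_apply, submatrix_apply,
    Equiv.symm_apply_apply]
  rcases i with i | i <;> rcases j with j | j
  · rfl
  · rfl
  · fin_cases i <;> rfl
  · fin_cases i <;> fin_cases j <;> rfl

theorem map_conj (P : Matrix (Fin n) (Fin n) ℤ) :
    (P * V * Pᵀ).map (Int.cast : ℤ → ℂ) =
      P.map Int.cast * V.map Int.cast * (P.map Int.cast)ᵀ := by
  change (P * V * Pᵀ).map (Int.castRingHom ℂ) = _
  rw [Matrix.map_mul, Matrix.map_mul]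
  rfl

theorem seifertHermitian_conj (P : Matrix (Fin n) (Fin n) ℤ) (t : ℂ) :
    (P * V * Pᵀ).seifertHermitian t =
      P.map (Int.cast : ℤ → ℂ) * V.seifertHermitian t * (P.map Int.cast)ᵀ := by
  rw [seifertHermitian, map_conj]
  simp only [seifertHermitian, transpose_mul, transpose_transpose, Matrix.mul_add,
    Matrix.add_mul, Matrix.mul_smul, Matrix.smul_mul, Matrix.mul_assoc]

theorem det_map_mul_self {P : Matrix (Fin n) (Fin n) ℤ} (hP : IsUnit P.det) :
    (P.map (Int.cast : ℤ → ℂ)).det * (P.map (Int.cast : ℤ → ℂ)).det = 1 := by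
  have h : (P.map (Int.cast : ℤ → ℂ)).det = (P.det : ℂ) := (Int.cast_det P).symm
  rw [h, ← Int.cast_mul, Int.isUnit_mul_self hP, Int.cast_one]

theorem alexanderAt_conj {P : Matrix (Fin n) (Fin n) ℤ} (hP : IsUnit P.det) (s : ℂ) :
    (P * V * Pᵀ).alexanderAt s = V.alexanderAt s := by
  have h : s • (P * V * Pᵀ).map (Int.cast : ℤ → ℂ) - s⁻¹ • ((P * V * Pᵀ).map Int.cast)ᵀ =
      P.map (Int.cast : ℤ → ℂ) * (s • V.map (Int.cast : ℤ → ℂ) - s⁻¹ • (V.map Int.cast)ᵀ) *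
        (P.map Int.cast)ᵀ := by
    rw [map_conj]
    simp only [transpose_mul, transpose_transpose, Matrix.mul_sub,
      Matrix.sub_mul, Matrix.mul_smul, Matrix.smul_mul, Matrix.mul_assoc]
  rw [alexanderAt, alexanderAt, h, det_mul, det_mul, det_transpose, mul_right_comm,
    det_map_mul_self hP, one_mul]

/-- The determinant of `B(s ^ 2)` in terms of the Alexander polynomial. -/
theorem det_seifertHermitian {s : ℂ} (hs : ‖s‖ = 1) :
    (V.seifertHermitian (s ^ 2)).det = (s⁻¹ - s) ^ n * V.alexanderAt s := by
  have hs0 : s ≠ 0 := by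
    rintro rfl
    simp at hs
  have hstar : star s = s⁻¹ := (Complex.inv_eq_conj hs).symm
  have h : V.seifertHermitian (s ^ 2) =
      (s⁻¹ - s) • (s • V.map (Int.cast : ℤ → ℂ) - s⁻¹ • (V.map Int.cast)ᵀ) := by
    rw [seifertHermitian, smul_sub, smul_smul, smul_smul, sub_eq_add_neg (_ • _), ← neg_smul,
      star_pow, hstar]
    congr 2 <;> field_simp
    ring
  rw [h, det_smul, Fintype.card_fin, alexanderAt]

theorem det_seifertHermitian_ne_zero {s : ℂ} (hs : ‖s‖ = 1) (hs1 : s ^ 2 ≠ 1)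
    (h : V.alexanderAt s ≠ 0) : (V.seifertHermitian (s ^ 2)).det ≠ 0 := by
  have hs0 : s ≠ 0 := by
    rintro rfl
    simp at hs
  rw [V.det_seifertHermitian hs]
  refine mul_ne_zero (pow_ne_zero _ fun h' => hs1 ?_) h
  have h2 := congrArg (· * s) (sub_eq_zero.1 h')
  simp only [inv_mul_cancel₀ hs0] at h2
  rw [sq, ← h2]

/-- Sylvester's law of inertia: the inverse of `Qᴴ` carries definite subspaces to definite
subspaces. Nondegeneracy turns this one-sided estimate into an equality. -/
theorem signatureAt_conj {P : Matrix (Fin n) (Fin n) ℤ} (hP : IsUnit P.det) {s : ℂ}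
    (hs : ‖s‖ = 1) (hs1 : s ^ 2 ≠ 1) (h : V.alexanderAt s ≠ 0) :
    (P * V * Pᵀ).signatureAt (s ^ 2) = V.signatureAt (s ^ 2) := by
  have h1 := V.det_seifertHermitian_ne_zero hs hs1 h
  have h2 := (P * V * Pᵀ).det_seifertHermitian_ne_zero hs hs1 (by rwa [V.alexanderAt_conj hP])
  refine (IsHermitian.signature_eq_of_index_le (k := 0) (V.seifertHermitian_isHermitian _)
    ((P * V * Pᵀ).seifertHermitian_isHermitian _) h1 h2 rfl fun ε _ => ?_).symm
  obtain ⟨f, hf⟩ := (V.seifertHermitian_isHermitian (s ^ 2)).exists_definite ε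
  let Q : Matrix (Fin n) (Fin n) ℂ := P.map Int.cast
  have hQ : Qᴴ = Qᵀ := by
    ext i j
    simp [Q]
  have hQu : IsUnit Qᴴ.det := by
    rw [hQ, det_transpose]
    exact IsUnit.of_mul_eq_one _ (det_map_mul_self hP)
  have h3 := ((P * V * Pᵀ).seifertHermitian_isHermitian (s ^ 2)).finrank_le_index ε
    ((Qᴴ⁻¹).mulVecLin ∘ₗ f) fun v hv => by
      have h4 := hf v hv
      have h5 : (P * V * Pᵀ).seifertHermitian (s ^ 2) = Q * V.seifertHermitian (s ^ 2) * Qᴴ := by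
        rw [hQ, seifertHermitian_conj]
      rw [h5, hermitianValue_conj, LinearMap.comp_apply, mulVecLin_apply, mulVec_mulVec,
        mul_nonsing_inv _ hQu, one_mulVec]
      exact h4
  rwa [Module.finrank_fintype_fun_eq_card, ← Nat.card_eq_fintype_card] at h3

/-- The new block `D` has determinant one, and the correction `B D⁻¹ C` in the Schur complement
vanishes because `D⁻¹` has zero diagonal. -/
theorem alexanderAt_enlargeCol (ξ : Fin n → ℤ) {s : ℂ} (hs : s ≠ 0) :
    (V.enlargeCol ξ).alexanderAt s = V.alexanderAt s := by
  let A : Matrix (Fin n) (Fin n) ℂ := s • V.map (Int.cast : ℤ → ℂ) - s⁻¹ • (V.map Int.cast)ᵀ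
  let B : Matrix (Fin n) (Fin 2) ℂ := of fun i => ![s * ξ i, 0]
  let C : Matrix (Fin 2) (Fin n) ℂ := of ![fun j => -s⁻¹ * ξ j, 0]
  let D : Matrix (Fin 2) (Fin 2) ℂ := !![0, s; -s⁻¹, 0]
  let E : Matrix (Fin 2) (Fin 2) ℂ := !![0, -s; s⁻¹, 0]
  have h : s • (V.enlargeCol ξ).map (Int.cast : ℤ → ℂ) -
      s⁻¹ • ((V.enlargeCol ξ).map Int.cast)ᵀ =
      reindex finSumFinEquiv finSumFinEquiv (fromBlocks A B C D) := by
    ext i j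
    obtain ⟨i, rfl⟩ := finSumFinEquiv.surjective i
    obtain ⟨j, rfl⟩ := finSumFinEquiv.surjective j
    simp only [enlargeCol, transpose_apply, reindex_apply, submatrix_apply, sub_apply, smul_apply,
      map_apply, Equiv.symm_apply_apply]
    rcases i with i | i <;> rcases j with j | j
    · simp [A]
    · fin_cases j <;> simp [B]
    · fin_cases i <;> simp [C]
    · fin_cases i <;> fin_cases j <;> simp [D]
  have hDE : D * E = 1 := by
    ext i j
    fin_cases i <;> fin_cases j <;> simp [D, E, hs]
  have hED : E * D = 1 := by
    ext i j
    fin_cases i <;> fin_cases j <;> simp [D, E, hs]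
  let _ : Invertible D := ⟨E, hED, hDE⟩
  have hBC : B * ⅟D * C = 0 := by
    change B * E * C = 0
    ext i j
    simp [B, E, C, Matrix.mul_apply, Fin.sum_univ_two]
  have hD : D.det = 1 := by simp [D, det_fin_two, hs]
  rw [alexanderAt, h, det_reindex_self, det_fromBlocks₂₂, hBC, hD, sub_zero, one_mul]
  rfl

/-- The value of the Hermitian form of a column enlargement, after a shear that splits off a
hyperbolic plane. -/
theorem hermitianValue_enlargeCol (ξ : Fin n → ℤ) (t : ℂ) (w : Fin n → ℂ) (a b : ℂ) :
    ((V.enlargeCol ξ).seifertHermitian t).hermitianValue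
      (Sum.elim w ![a, b] ∘ finSumFinEquiv.symm) =
    (V.seifertHermitian t).hermitianValue w +
      2 * (star a * ((1 - star t) * ∑ i, ξ i * w i + (1 - t) * b)).re := by
  let B : Matrix (Fin n) (Fin 2) ℂ := of fun i => ![(1 - t) * ξ i, 0]
  let C : Matrix (Fin 2) (Fin n) ℂ := of ![fun j => (1 - star t) * ξ j, 0]
  let D : Matrix (Fin 2) (Fin 2) ℂ := !![0, 1 - t; 1 - star t, 0]
  have h : (V.enlargeCol ξ).seifertHermitian t =
      (fromBlocks (V.seifertHermitian t) B C D).submatrix finSumFinEquiv.symm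
        finSumFinEquiv.symm := by
    ext i j
    obtain ⟨i, rfl⟩ := finSumFinEquiv.surjective i
    obtain ⟨j, rfl⟩ := finSumFinEquiv.surjective j
    simp only [enlargeCol, seifertHermitian, transpose_apply, reindex_apply, submatrix_apply,
      add_apply, smul_apply, map_apply, Equiv.symm_apply_apply]
    rcases i with i | i <;> rcases j with j | j
    · simp
    · fin_cases j <;> simp [B]
    · fin_cases i <;> simp [C]
    · fin_cases i <;> fin_cases j <;> simp [D]
  have hstar : star (Sum.elim w ![a, b]) = Sum.elim (star w) (star ![a, b]) := by
    ext i
    rcases i with i | i <;> rfl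
  have h1 : star w ⬝ᵥ B *ᵥ ![a, b] = star (star a * ((1 - star t) * ∑ i, ξ i * w i)) := by
    simp only [dotProduct, mulVec, Fin.sum_univ_two, B, of_apply, cons_val_zero, cons_val_one,
      star_mul', star_sub, star_one, star_star, star_sum, Finset.mul_sum]
    refine Finset.sum_congr rfl fun i _ => ?_
    simp
    ring
  have h2 : star ![a, b] ⬝ᵥ (C *ᵥ w + D *ᵥ ![a, b]) =
      star a * ((1 - star t) * ∑ i, ξ i * w i + (1 - t) * b) + star (star a * ((1 - t) * b)) := by
    simp only [dotProduct, mulVec, Fin.sum_univ_two, C, D, of_apply, cons_val_zero, cons_val_one,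
      star_mul', star_sub, star_one, star_star, Finset.mul_sum, Pi.add_apply, Pi.star_apply]
    simp [mul_assoc]
    ring
  rw [h, hermitianValue_submatrix, hermitianValue, fromBlocks_mulVec, hstar,
    sumElim_dotProduct_sumElim, hermitianValue]
  simp only [Sum.elim_comp_inl, Sum.elim_comp_inr]
  rw [dotProduct_add, h1, h2]
  simp only [Complex.add_re, mul_add, Complex.star_def, Complex.conj_re]
  ring

/-- The enlargement adds a hyperbolic plane, which raises each of the two indices by one. -/
theorem signatureAt_enlargeCol (ξ : Fin n → ℤ) {s : ℂ}
    (hs : ‖s‖ = 1) (hs1 : s ^ 2 ≠ 1) (h : V.alexanderAt s ≠ 0) :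
    V.signatureAt (s ^ 2) = (V.enlargeCol ξ).signatureAt (s ^ 2) := by
  have hs0 : s ≠ 0 := by
    rintro rfl
    simp at hs
  have h1 := V.det_seifertHermitian_ne_zero hs hs1 h
  have h2 := (V.enlargeCol ξ).det_seifertHermitian_ne_zero hs hs1
    (by rwa [V.alexanderAt_enlargeCol ξ hs0])
  refine IsHermitian.signature_eq_of_index_le (k := 1) (V.seifertHermitian_isHermitian _)
    ((V.enlargeCol ξ).seifertHermitian_isHermitian _) h1 h2 rfl fun ε hε => ?_
  obtain ⟨f, hf⟩ := (V.seifertHermitian_isHermitian (s ^ 2)).exists_definite ε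
  have ht : 1 - s ^ 2 ≠ 0 := sub_ne_zero.2 hs1.symm
  let L : (Fin n → ℂ) →ₗ[ℂ] ℂ := ∑ i, (ξ i : ℂ) • LinearMap.proj i
  have hL : ∀ w, L w = ∑ i, ξ i * w i := fun w => by simp [L]
  -- The last coordinate solves `(1 - t̄) L w + (1 - t) b = ε a`, so that the cross term becomes `2
  -- ε |a|²`; this needs `t ≠ 1`.
  let g : (Fin n → ℂ) × ℂ →ₗ[ℂ] Fin (n + 2) → ℂ :=
    { toFun := fun p => Sum.elim p.1
        ![p.2, (1 - s ^ 2)⁻¹ * (ε * p.2 - (1 - star (s ^ 2)) * L p.1)] ∘ finSumFinEquiv.symm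
      map_add' := fun p q => by
        ext i
        obtain ⟨i, rfl⟩ := finSumFinEquiv.surjective i
        simp only [Function.comp_apply, Pi.add_apply, Equiv.symm_apply_apply]
        rcases i with i | i
        · rfl
        · fin_cases i
          · rfl
          · simp
            ring
      map_smul' := fun k p => by
        ext i
        obtain ⟨i, rfl⟩ := finSumFinEquiv.surjective i
        simp only [Function.comp_apply, Pi.smul_apply, Equiv.symm_apply_apply]
        rcases i with i | i
        · rfl
        · fin_cases i
          · rfl
          · simp
            ring }
  have hg : ∀ p, ((V.enlargeCol ξ).seifertHermitian (s ^ 2)).hermitianValue (g p) =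
      (V.seifertHermitian (s ^ 2)).hermitianValue p.1 + 2 * ε * Complex.normSq p.2 := by
    intro p
    change hermitianValue _ (Sum.elim p.1
        ![p.2, (1 - s ^ 2)⁻¹ * (ε * p.2 - (1 - star (s ^ 2)) * L p.1)] ∘ finSumFinEquiv.symm) = _
    rw [hermitianValue_enlargeCol, mul_inv_cancel_left₀ ht, hL, add_sub_cancel]
    have : star p.2 * (ε * p.2) = ((ε * Complex.normSq p.2 : ℝ) : ℂ) := by
      push_cast
      rw [Complex.normSq_eq_conj_mul_self, Complex.star_def]
      ring
    rw [this, Complex.ofReal_re]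
    ring
  have h3 := ((V.enlargeCol ξ).seifertHermitian_isHermitian (s ^ 2)).finrank_le_index ε
    (g ∘ₗ f.prodMap LinearMap.id) fun v hv => by
      obtain ⟨v, a⟩ := v
      rw [LinearMap.comp_apply, hg]
      simp only [LinearMap.prodMap_apply, LinearMap.id_apply]
      have h5 : ε * (hermitianValue (V.seifertHermitian (s ^ 2)) (f v) +
          2 * ε * Complex.normSq a) =
          ε * hermitianValue (V.seifertHermitian (s ^ 2)) (f v) + 2 * Complex.normSq a := by
        linear_combination (2 * Complex.normSq a) * hε
      rw [h5]
      by_cases hv0 : v = 0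
      · have ha : a ≠ 0 := by
          rintro rfl
          exact hv (by rw [hv0]; rfl)
        have := Complex.normSq_pos.2 ha
        rw [hv0, map_zero]
        simpa [hermitianValue] using this
      · have h6 := hf v hv0
        have h7 := Complex.normSq_nonneg a
        linarith
  rwa [Module.finrank_prod, Module.finrank_fintype_fun_eq_card, ← Nat.card_eq_fintype_card,
    Module.finrank_self] at h3

theorem SEquiv.alexanderAt_eq {m n : ℕ} {V : Matrix (Fin m) (Fin m) ℤ}
    {W : Matrix (Fin n) (Fin n) ℤ} (h : SEquiv V W) {s : ℂ} (hs : s ≠ 0) :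
    V.alexanderAt s = W.alexanderAt s := by
  induction h with
  | refl V => rfl
  | symm _ ih => exact ih.symm
  | trans _ _ ih₁ ih₂ => exact ih₁.trans ih₂
  | congr V P hP => exact (V.alexanderAt_conj hP s).symm
  | enlargeCol V ξ => exact (V.alexanderAt_enlargeCol ξ hs).symm
  | enlargeRow V ξ =>
    rw [enlargeRow_eq_transpose, alexanderAt_transpose, alexanderAt_enlargeCol _ _ hs,
      alexanderAt_transpose]

/-- Nonvanishing of the Alexander value is itself invariant, so nondegeneracy is available at every
link of the chain. -/
theorem SEquiv.signatureAt_eq {m n : ℕ} {V : Matrix (Fin m) (Fin m) ℤ}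
    {W : Matrix (Fin n) (Fin n) ℤ} (h : SEquiv V W) {s : ℂ} (hs : ‖s‖ = 1) (hs1 : s ^ 2 ≠ 1)
    (hV : V.alexanderAt s ≠ 0) : V.signatureAt (s ^ 2) = W.signatureAt (s ^ 2) := by
  have hs0 : s ≠ 0 := by
    rintro rfl
    simp at hs
  induction h with
  | refl V => rfl
  | symm h ih => exact (ih (by rwa [h.alexanderAt_eq hs0])).symm
  | trans h _ ih₁ ih₂ => exact (ih₁ hV).trans (ih₂ (by rwa [← h.alexanderAt_eq hs0]))
  | congr V P hP => exact (V.signatureAt_conj hP hs hs1 hV).symm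
  | enlargeCol V ξ => exact V.signatureAt_enlargeCol ξ hs hs1 hV
  | enlargeRow V ξ =>
    -- Transposition conjugates `s ^ 2`, so the column case is applied to `Vᵀ` at `s⁻¹`.
    have hstar : star (s ^ 2) = s⁻¹ ^ 2 := by
      rw [star_pow, Complex.inv_eq_conj hs, Complex.star_def]
    rw [enlargeRow_eq_transpose, signatureAt_transpose, hstar,
      ← Vᵀ.signatureAt_enlargeCol ξ (by rw [norm_inv, hs, inv_one]) ?_ ?_, ← hstar,
      signatureAt_transpose, star_star]
    · rwa [inv_pow, Ne, inv_eq_one]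
    · rw [alexanderAt_transpose, alexanderAt_inv]
      exact mul_ne_zero (pow_ne_zero _ (by simp)) hV

end SEquivalence

end Matrix

/-! ### The signature jump under a rank one change -/

namespace Matrix

/-- On the unit circle the conjugate transpose of the matrix at `s` is the transpose of the matrix
at `s⁻¹`, and for even size the value at `s⁻¹` is the value at `s`. -/
theorem alexanderAt_im {n : ℕ} (V : Matrix (Fin n) (Fin n) ℤ) (hn : Even n) {s : ℂ}
    (hs : ‖s‖ = 1) : (V.alexanderAt s).im = 0 := by
  have hstar : star s = s⁻¹ := (Complex.inv_eq_conj hs).symm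
  have h : (s • V.map (Int.cast : ℤ → ℂ) - s⁻¹ • (V.map Int.cast)ᵀ)ᴴ =
      (s⁻¹ • V.map (Int.cast : ℤ → ℂ) - s⁻¹⁻¹ • (V.map Int.cast)ᵀ)ᵀ := by
    ext i j
    simp [hstar]
  rw [← Complex.conj_eq_iff_im, ← Complex.star_def]
  conv_lhs => rw [alexanderAt]
  rw [← det_conjTranspose, h, det_transpose, ← alexanderAt, alexanderAt_inv, hn.neg_one_pow,
    one_mul]

theorem signatureAt_one {n : ℕ} (V : Matrix (Fin n) (Fin n) ℤ) : V.signatureAt 1 = 0 := by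
  have h : V.seifertHermitian 1 = 0 := by simp [seifertHermitian]
  have h0 := (V.seifertHermitian_isHermitian 1).eigenvalues_eq_zero_iff.2 h
  simp [signatureAt, IsHermitian.signature, h0]

section RankOne

variable {n : ℕ} {V W : Matrix (Fin n) (Fin n) ℤ} {a : Fin n → ℤ}

/-- On the unit circle `(1 - t) + (1 - t̄) = |1 - t|²`. -/
theorem hermitianValue_seifertHermitian_sub (h : W = V - vecMulVec a a) {t : ℂ} (ht : ‖t‖ = 1)
    (x : Fin n → ℂ) :
    (W.seifertHermitian t).hermitianValue x = (V.seifertHermitian t).hermitianValue x -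
      Complex.normSq (1 - t) * Complex.normSq ((∑ i, (a i : ℂ) • LinearMap.proj i :
        (Fin n → ℂ) →ₗ[ℂ] ℂ) x) := by
  have htt : t * star t = 1 := by
    rw [Complex.star_def, Complex.mul_conj, Complex.normSq_eq_norm_sq, ht]
    simp
  have h1 : W.seifertHermitian t = V.seifertHermitian t -
      (Complex.normSq (1 - t) : ℂ) • vecMulVec (fun i => (a i : ℂ)) (fun i => (a i : ℂ)) := by
    ext i j
    rw [Complex.normSq_eq_conj_mul_self, map_sub, map_one, ← Complex.star_def]
    simp only [h, seifertHermitian, add_apply, smul_apply, map_apply, transpose_apply, sub_apply,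
      vecMulVec_apply, Int.cast_sub, Int.cast_mul, smul_eq_mul]
    linear_combination ((a i : ℂ) * a j) * htt
  have h2 : (∑ i, (a i : ℂ) • LinearMap.proj i : (Fin n → ℂ) →ₗ[ℂ] ℂ) x =
      (fun i => (a i : ℂ)) ⬝ᵥ x := by
    simp [dotProduct]
  have h3 : star x ⬝ᵥ (fun i => (a i : ℂ)) = star ((fun i => (a i : ℂ)) ⬝ᵥ x) := by
    simp [dotProduct, mul_comm]
  rw [h1, h2, hermitianValue, hermitianValue, sub_mulVec, dotProduct_sub, smul_mulVec,
    vecMulVec_mulVec, dotProduct_smul]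
  simp only [op_smul_eq_smul, dotProduct_smul, h3, smul_eq_mul, Complex.star_def]
  rw [Complex.mul_conj, ← Complex.ofReal_mul, Complex.sub_re, Complex.ofReal_re]

/-- The signature jump between two Seifert forms that differ by the square of a linear form. -/
theorem signatureAt_sub_of_rank_one (hn : Even n) (h : W = V - vecMulVec a a) {s : ℂ}
    (hs : ‖s‖ = 1) (h0 : W.alexanderAt s * V.alexanderAt s ≠ 0) :
    (W.alexanderAt s * V.alexanderAt s).im = 0 ∧
    ((W.alexanderAt s * V.alexanderAt s).re < 0 →
      V.signatureAt (s ^ 2) - W.signatureAt (s ^ 2) = 2) ∧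
    (0 < (W.alexanderAt s * V.alexanderAt s).re →
      V.signatureAt (s ^ 2) - W.signatureAt (s ^ 2) = 0) := by
  have hs0 : s ≠ 0 := by
    rintro rfl
    simp at hs
  have hVi := V.alexanderAt_im hn hs
  have hWi := W.alexanderAt_im hn hs
  have hre : (W.alexanderAt s * V.alexanderAt s).re =
      (W.alexanderAt s).re * (V.alexanderAt s).re := by
    rw [Complex.mul_re, hVi, hWi, mul_zero, sub_zero]
  refine ⟨by rw [Complex.mul_im, hVi, hWi, mul_zero, zero_mul, add_zero], ?_⟩
  rw [hre]
  by_cases hs1 : s ^ 2 = 1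
  -- Here `s⁻¹ = s`, so only `V - Vᵀ` matters and the symmetric matrix `a aᵀ` cancels. The product
  -- is then a square, and both signatures vanish.
  · have hWV : W.alexanderAt s = V.alexanderAt s := by
      have hss : s⁻¹ = s := inv_eq_of_mul_eq_one_left (by rw [← sq, hs1])
      rw [alexanderAt, alexanderAt, hss]
      congr 1
      ext i j
      simp only [h, sub_apply, smul_apply, map_apply, transpose_apply, vecMulVec_apply,
        Int.cast_sub, Int.cast_mul, smul_eq_mul]
      ring
    rw [hWV, hs1, signatureAt_one, signatureAt_one]
    exact ⟨fun h => absurd h (mul_self_nonneg _).not_gt, fun _ => sub_self 0⟩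
  have hV0 := right_ne_zero_of_mul h0
  have hW0 := left_ne_zero_of_mul h0
  have hVd := V.det_seifertHermitian_ne_zero hs hs1 hV0
  have hWd := W.det_seifertHermitian_ne_zero hs hs1 hW0
  have hVp := (V.seifertHermitian_isHermitian (s ^ 2)).det_pos_of_index hVd
  have hWp := (W.seifertHermitian_isHermitian (s ^ 2)).det_pos_of_index hWd
  have hVs := (V.seifertHermitian_isHermitian (s ^ 2)).index_add_index hVd
  have hWs := (W.seifertHermitian_isHermitian (s ^ 2)).index_add_index hWd
  obtain ⟨h1, h2⟩ := (V.seifertHermitian_isHermitian (s ^ 2)).index_sub_rank_one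
    (W.seifertHermitian_isHermitian (s ^ 2)) (Complex.normSq_nonneg (1 - s ^ 2)) _
    (hermitianValue_seifertHermitian_sub h (by rw [norm_pow, hs, one_pow]))
  -- The number `s⁻¹ - s` is purely imaginary with square `-4 (Im s)²`, so its even powers are real.
  have hR : ∃ R : ℝ, (s⁻¹ - s) ^ n = R := by
    obtain ⟨k, rfl⟩ := hn
    refine ⟨(-(4 * s.im ^ 2)) ^ k, ?_⟩
    rw [← two_mul, pow_mul, Complex.ofReal_pow]
    congr 1
    rw [Complex.inv_eq_conj hs]
    apply Complex.ext <;> simp [sq]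
    ring
  obtain ⟨R, hR⟩ := hR
  rw [V.det_seifertHermitian hs, hR, Complex.re_ofReal_mul] at hVp
  rw [W.det_seifertHermitian hs, hR, Complex.re_ofReal_mul] at hWp
  have hp := mul_pos hVp hWp
  unfold signatureAt
  rw [IsHermitian.signature_eq, IsHermitian.signature_eq]
  generalize (V.seifertHermitian_isHermitian (s ^ 2)).index 1 = p at *
  generalize (V.seifertHermitian_isHermitian (s ^ 2)).index (-1) = q at *
  generalize (W.seifertHermitian_isHermitian (s ^ 2)).index 1 = p' at *
  generalize (W.seifertHermitian_isHermitian (s ^ 2)).index (-1) = q' at *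
  have hqq : (-1 : ℝ) ^ q * (-1 : ℝ) ^ q = 1 := by rw [← mul_pow]; simp
  have hRR := mul_self_nonneg R
  -- Since `p + q = p' + q'`, the drop in positive eigenvalues, 0 or 1, is the gain in negative
  -- ones. The sign of the product of the determinants, freed of the square `R * R`, tells the two
  -- cases apart.
  obtain hq | hq : q' = q ∨ q' = q + 1 := by omega
  · have h3 : 0 < R * R * ((W.alexanderAt s).re * (V.alexanderAt s).re) := by
      rw [hq] at hp
      refine hp.trans_eq ?_
      linear_combination (R * R * ((W.alexanderAt s).re * (V.alexanderAt s).re)) * hqq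
    have h4 := pos_of_mul_pos_right h3 hRR
    exact ⟨fun h5 => absurd h5 h4.not_gt, fun _ => by omega⟩
  · have h3 : 0 < R * R * -((W.alexanderAt s).re * (V.alexanderAt s).re) := by
      rw [hq, pow_succ] at hp
      refine hp.trans_eq ?_
      linear_combination -(R * R * ((W.alexanderAt s).re * (V.alexanderAt s).re)) * hqq
    have h4 := pos_of_mul_pos_right h3 hRR
    exact ⟨fun _ => by omega, fun h5 => by linarith⟩

end RankOne

end Matrix

/-! ### Effect of a crossing change on the Seifert form -/

namespace KnotDiagram

variable {X : Type*} [Fintype X] [DecidableEq X] (K : KnotDiagram X) (c : X)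

/-- Only the summand at `c` changes: it reads the weight of `z` after or before the corner `(c,
false)`, and Kirchhoff's law says that these differ by the weight on the band. -/
theorem seifertForm_withSign (z w : K.homology) :
    (K.withSign c 1).seifertForm z w =
      (K.withSign c (-1)).seifertForm z w - z.1.1 c * w.1.1 c := by
  have h : ∀ e : ℤˣ, (K.withSign c e).seifertForm z w =
      w.1.1 c * (if e = 1 then z.1.2 (c, false) else z.1.2 (K.seifertPerm.symm (c, false))) +
      ∑ d ∈ Finset.univ.erase c, w.1.1 d * (if K.sign d = 1 then z.1.2 (d, false)
        else z.1.2 (K.seifertPerm.symm (d, false))) := by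
    intro e
    change ∑ d, w.1.1 d * (if (K.withSign c e).sign d = 1 then z.1.2 (d, false)
      else z.1.2 (K.seifertPerm.symm (d, false))) = _
    rw [← Finset.add_sum_erase _ _ (Finset.mem_univ c)]
    congr 1
    · simp [withSign]
    · refine Finset.sum_congr rfl fun d hd => ?_
      simp [withSign, Function.update_of_ne (Finset.ne_of_mem_erase hd)]
  have h1 := z.2.1 (c, false)
  simp only [Shadow.inflow, Bool.false_eq_true, if_false] at h1
  rw [h, h, if_pos rfl, if_neg (by decide), h1]
  ring

end KnotDiagram

/-- The Seifert matrices in different bases of the homology are congruent. -/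
theorem KnotDiagram.sEquiv_of_basis {X : Type*} [Fintype X] (K : KnotDiagram X) {n : ℕ}
    (b b' : Module.Basis (Fin n) ℤ K.homology) :
    Matrix.SEquiv (Matrix.of fun i j => K.seifertForm (b i) (b j))
      (Matrix.of fun i j => K.seifertForm (b' i) (b' j)) := by
  let B : LinearMap.BilinForm ℤ K.homology :=
    LinearMap.mk₂ ℤ K.seifertForm
      (fun z z' w => by
        simp only [seifertForm, ← Finset.sum_add_distrib, ← mul_add]
        refine Finset.sum_congr rfl fun d _ => ?_
        split_ifs <;> rfl)
      (fun k z w => by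
        simp only [seifertForm, smul_eq_mul, Finset.mul_sum]
        refine Finset.sum_congr rfl fun d _ => ?_
        split_ifs <;> simp <;> ring)
      (fun z w w' => by
        simp only [seifertForm, ← Finset.sum_add_distrib, ← add_mul]
        rfl)
      (fun k z w => by
        simp only [seifertForm, smul_eq_mul, Finset.mul_sum, ← mul_assoc]
        rfl)
  have hB : ∀ e : Module.Basis (Fin n) ℤ K.homology,
      Matrix.of (fun i j => K.seifertForm (e i) (e j)) = LinearMap.BilinForm.toMatrix e B := by
    intro e
    ext i j
    rw [LinearMap.BilinForm.toMatrix_apply]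
    rfl
  rw [hB, hB, ← LinearMap.BilinForm.toMatrix_mul_basis_toMatrix b b' B, ← hB]
  -- The congruence has the form `P * V * Pᵀ` with `P` the transpose of the transition matrix.
  conv => enter [2, 2]; rw [← Matrix.transpose_transpose (b.toMatrix b')]
  refine Matrix.SEquiv.congr _ _ ?_
  rw [Matrix.det_transpose]
  exact IsUnit.of_mul_eq_one _ (by
    rw [← Matrix.det_mul, b.toMatrix_mul_toMatrix_flip b', Matrix.det_one])

theorem lemma2p2 {X : Type*} [Fintype X] [DecidableEq X] (K : KnotDiagram X) (c : X)
    {m n : ℕ} (Vpos : Matrix (Fin m) (Fin m) ℤ) (Vneg : Matrix (Fin n) (Fin n) ℤ)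
    (hpos : (K.withSign c 1).IsSeifertMatrix Vpos)
    (hneg : (K.withSign c (-1)).IsSeifertMatrix Vneg)
    (θ : ℝ) (ρ s : ℂ) (hρ : ρ = Complex.exp (Complex.I * θ)) (hs : s ^ 2 = ρ)
    (h : Vpos.alexanderAt s * Vneg.alexanderAt s ≠ 0) :
    (Vpos.alexanderAt s * Vneg.alexanderAt s).im = 0 ∧
    ((Vpos.alexanderAt s * Vneg.alexanderAt s).re < 0 →
      Vneg.signatureAt ρ - Vpos.signatureAt ρ = 2) ∧
    (0 < (Vpos.alexanderAt s * Vneg.alexanderAt s).re →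
      Vneg.signatureAt ρ - Vpos.signatureAt ρ = 0) := by
  have hs1 : ‖s‖ = 1 := by
    have h1 : ‖s‖ ^ 2 = 1 := by
      rw [← norm_pow, hs, hρ, mul_comm, Complex.norm_exp_ofReal_mul_I]
    exact (pow_eq_one_iff_of_nonneg (norm_nonneg s) two_ne_zero).1 h1
  have hs0 : s ≠ 0 := by
    rintro rfl
    simp at hs1
  obtain ⟨k, b, hb⟩ := hpos
  obtain ⟨l, b', hb'⟩ := hneg
  have : Nonempty X := ⟨c⟩
  have hk : Module.finrank ℤ K.homology = k := Module.finrank_eq_card_basis b |>.trans (by simp)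
  have hl : Module.finrank ℤ K.homology = l := Module.finrank_eq_card_basis b' |>.trans (by simp)
  obtain rfl : k = l := hk.symm.trans hl
  -- Both forms must be written in the same basis `b` for their matrices to differ by rank one.
  have hb'' := ((K.withSign c (-1)).sEquiv_of_basis b b').trans hb'
  have heven : Even k := hk ▸ K.even_finrank_homology
  have hVW : Matrix.of (fun i j => (K.withSign c 1).seifertForm (b i) (b j)) =
      Matrix.of (fun i j => (K.withSign c (-1)).seifertForm (b i) (b j)) -
        Matrix.vecMulVec (fun i => (b i).1.1 c) (fun i => (b i).1.1 c) := by
    ext i j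
    exact K.seifertForm_withSign c (b i) (b j)
  rw [← hb.alexanderAt_eq hs0, ← hb''.alexanderAt_eq hs0] at h ⊢
  have key := Matrix.signatureAt_sub_of_rank_one heven hVW hs1 h
  rw [← hs]
  -- At `ρ = 1` the form is degenerate and `SEquiv.signatureAt_eq` does not apply, but all
  -- signatures are zero.
  by_cases hρ1 : s ^ 2 = 1
  · rw [hρ1, Matrix.signatureAt_one, Matrix.signatureAt_one] at key ⊢
    exact key
  · rwa [← hb.signatureAt_eq hs1 hρ1 (left_ne_zero_of_mul h),
      ← hb''.signatureAt_eq hs1 hρ1 (right_ne_zero_of_mul h)]
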